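/- Consider vertex-weighted online bipartite matching with stochastic rewards. An instance $G$ consists of finitely many resources $i\in I$ with weights $r_i\ge 0$, finitely many arrivals $t\in T$ in a fixed order, and a set $E\subseteq I\times T$ of edges with arbitrary success probabilities $p_{it}\in[0,1]$. If $t$ is matched to an available resource $i$ with $(i,t)\in E$, then, independently of everything else, with probability $p_{it}$ the match succeeds, a reward $r_i$ is earned and $i$ becomes unavailable; otherwise nothing is earned and $i$ remains available. In either case $t$ departs. Perturbed Greedy draws i.i.d. seeds $y_i$, uniform on $[0,1]$, and offers to each arrival $t$ in turn an available resource $i$ with $(i,t)\in E$ that maximizes $p_{it}\,r_i\,(1-e^{y_i-1})$ (none if there is no such resource). Let $\mathrm{ALG}(G)$ be its expected total reward, and let $\mathrm{OPT}(G)$ be the supremum of the expected total reward over all adaptive non-anticipative offline policies, which know the whole instance and may match the arrivals in any order, each at most once, but learn whether an edge succeeds only after including it in the matching. Theorem. The competitive ratio of Perturbed Greedy satisfies $$\inf_{G:\ \mathrm{OPT}(G)>0}\ \frac{\mathrm{ALG}(G)}{\mathrm{OPT}(G)}\ \le\ 0.624\ <\ 1-\frac1e .$$ -/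

import Mathlib

open MeasureTheory

noncomputable section

/-- An instance of vertex-weighted online bipartite matching with stochastic rewards, with `n`
resources (known in advance) and `m` arrivals (arriving in the order of their index).
`edges` is the edge set, `weight i` the reward `r_i` of resource `i`, and `prob i t` the success
probability `p_{it}` of the edge `(i, t)`; its value on non-edges is never used. -/
structure StochasticMatching (n m : ℕ) where
  edges : Finset (Fin n × Fin m)
  weight : Fin n → ℝ
  prob : Fin n → Fin m → ℝ
  weight_nonneg : ∀ i, 0 ≤ weight i
  prob_nonneg : ∀ i t, (i, t) ∈ edges → 0 ≤ prob i t
  prob_le_one : ∀ i t, (i, t) ∈ edges → prob i t ≤ 1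

namespace StochasticMatching

variable {n m : ℕ}

/-! ### The Perturbed Greedy algorithm -/

/-- The available resources (those in `S`) that have an edge to the arrival `t`. -/
def candidates (G : StochasticMatching n m) (S : Finset (Fin n)) (t : Fin m) : Finset (Fin n) :=
  S.filter fun i => (i, t) ∈ G.edges

/-- The perturbed expected reward `p_{it} r_i (1 - e^{y_i - 1})`. -/
def perturbedReward (G : StochasticMatching n m) (y : Fin n → ℝ) (t : Fin m) (i : Fin n) : ℝ :=
  G.prob i t * G.weight i * (1 - Real.exp (y i - 1))

open Classical in
/-- The candidates of maximum perturbed expected reward. -/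
def maximizers (G : StochasticMatching n m) (y : Fin n → ℝ) (S : Finset (Fin n)) (t : Fin m) :
    Finset (Fin n) :=
  (G.candidates S t).filter fun i =>
    ∀ j ∈ G.candidates S t, G.perturbedReward y t j ≤ G.perturbedReward y t i

/-- The resource that Perturbed Greedy offers to the arrival `t` when `S` is the set of available
resources: a maximizer of the perturbed expected reward, or `none` if no available resource has an
edge to `t`. Ties (which, for `y` uniform, almost surely occur only between resources of perturbed
expected reward `0`) are broken by smallest index. -/
def greedyChoice (G : StochasticMatching n m) (y : Fin n → ℝ) (S : Finset (Fin n)) (t : Fin m) :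
    Option (Fin n) :=
  if h : (G.maximizers y S t).Nonempty then some ((G.maximizers y S t).min' h) else none

/-- The expected total reward (over the independent successes and failures of the offered edges)
of Perturbed Greedy with seeds `y`, from the moment when the remaining arrivals are those in the
list and the set of available resources is `S`. -/
def greedyRewardFrom (G : StochasticMatching n m) (y : Fin n → ℝ) :
    List (Fin m) → Finset (Fin n) → ℝ
  | [], _ => 0
  | t :: ts, S =>
    match G.greedyChoice y S t with
    | none => G.greedyRewardFrom y ts S
    | some i =>
      G.prob i t * (G.weight i + G.greedyRewardFrom y ts (S.erase i)) +
        (1 - G.prob i t) * G.greedyRewardFrom y ts S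

/-- The law of the seeds: i.i.d. uniform on `[0, 1]`. -/
def seedLaw (n : ℕ) : Measure (Fin n → ℝ) :=
  Measure.pi fun _ => volume.restrict (Set.Icc (0 : ℝ) 1)

/-- The expected total reward of Perturbed Greedy on the instance `G`. -/
def perturbedGreedy (G : StochasticMatching n m) : ℝ :=
  ∫ y, G.greedyRewardFrom y (List.finRange m) Finset.univ ∂(seedLaw n)

/-! ### The non-anticipative offline benchmark -/

/-- A non-anticipative adaptive offline policy, as a decision tree: either finish, or include an edge
`(i, t)` in the matching and continue depending on whether this edge succeeds or fails.
Edges may be tried in any order of the arrivals. -/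
inductive OfflinePolicy (n m : ℕ) : Type
  | finish : OfflinePolicy n m
  | tryEdge (i : Fin n) (t : Fin m) (onSuccess onFailure : OfflinePolicy n m) : OfflinePolicy n m

/-- The policy is feasible when `S` is the set of available resources and `U` is the set of
unused arrivals: only edges between them are tried, an arrival is used at most once
(whether the match succeeds or fails), and a resource becomes unavailable once it is matched
successfully. -/
def Feasible (G : StochasticMatching n m) :
    OfflinePolicy n m → Finset (Fin n) → Finset (Fin m) → Prop
  | .finish, _, _ => True
  | .tryEdge i t succ fail, S, U =>
    i ∈ S ∧ t ∈ U ∧ (i, t) ∈ G.edges ∧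
      G.Feasible succ (S.erase i) (U.erase t) ∧ G.Feasible fail S (U.erase t)

/-- The expected total reward of an offline policy. -/
def policyValue (G : StochasticMatching n m) : OfflinePolicy n m → ℝ
  | .finish => 0
  | .tryEdge i t succ fail =>
    G.prob i t * (G.weight i + G.policyValue succ) + (1 - G.prob i t) * G.policyValue fail

/-- The optimal expected total reward of a non-anticipative offline policy that knows the whole
instance except for the realizations of the edges. -/
def offlineOpt (G : StochasticMatching n m) : ℝ :=
  sSup {v : ℝ | ∃ π : OfflinePolicy n m,
    G.Feasible π Finset.univ Finset.univ ∧ v = G.policyValue π}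

/-! ### The competitive ratio -/

/-- All ratios `ALG(G) / OPT(G)` for Perturbed Greedy, over all instances with `OPT(G) > 0`. -/
def perturbedGreedyRatios : Set ℝ :=
  {x : ℝ | ∃ (n m : ℕ) (G : StochasticMatching n m),
    0 < G.offlineOpt ∧ x = G.perturbedGreedy / G.offlineOpt}

/-- The competitive ratio of Perturbed Greedy. -/
def perturbedGreedyCompetitiveRatio : ℝ := sInf perturbedGreedyRatios

/-! ### The integral, the supremum and the infimum above are meaningful -/

instance (n : ℕ) : IsProbabilityMeasure (seedLaw n) := by
  have : IsProbabilityMeasure (volume.restrict (Set.Icc (0 : ℝ) 1)) := ⟨by simp⟩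
  unfold seedLaw
  infer_instance

lemma greedyChoice_mem (G : StochasticMatching n m) {y : Fin n → ℝ} {S : Finset (Fin n)}
    {t : Fin m} {i : Fin n} (h : G.greedyChoice y S t = some i) : i ∈ S ∧ (i, t) ∈ G.edges := by
  unfold greedyChoice at h
  split_ifs at h with hne
  have hm := Finset.min'_mem _ hne
  rw [Option.some.inj h] at hm
  simp only [maximizers, candidates, Finset.mem_filter] at hm
  exact hm.1

lemma greedyRewardFrom_mem (G : StochasticMatching n m) (y : Fin n → ℝ) (ts : List (Fin m))
    (S : Finset (Fin n)) :
    0 ≤ G.greedyRewardFrom y ts S ∧ G.greedyRewardFrom y ts S ≤ ∑ i ∈ S, G.weight i := by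
  induction ts generalizing S with
  | nil => exact ⟨le_rfl, Finset.sum_nonneg fun i _ => G.weight_nonneg i⟩
  | cons t ts ih =>
    unfold greedyRewardFrom
    split
    · exact ih S
    · rename_i i hi
      obtain ⟨hS, hE⟩ := G.greedyChoice_mem hi
      have h0 := G.prob_nonneg i t hE
      have h1 := G.prob_le_one i t hE
      have hw := G.weight_nonneg i
      have hs := Finset.add_sum_erase S G.weight hS
      obtain ⟨a1, a2⟩ := ih S
      obtain ⟨b1, b2⟩ := ih (S.erase i)
      constructor
      · have := mul_nonneg h0 (add_nonneg hw b1)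
        have := mul_nonneg (sub_nonneg.2 h1) a1
        linarith
      · have := mul_le_mul_of_nonneg_left
          (show G.weight i + G.greedyRewardFrom y ts (S.erase i) ≤ ∑ i ∈ S, G.weight i by linarith)
          h0
        have := mul_le_mul_of_nonneg_left a2 (sub_nonneg.2 h1)
        linarith

lemma measurableSet_greedyChoice (G : StochasticMatching n m) (S : Finset (Fin n)) (t : Fin m)
    (o : Option (Fin n)) : MeasurableSet {y | G.greedyChoice y S t = o} := by
  have hmeas : ∀ i, MeasurableSet {y | i ∈ G.maximizers y S t} := by
    intro i
    have heq : {y | i ∈ G.maximizers y S t} = {_y | i ∈ G.candidates S t} ∩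
        ⋂ j, {y | j ∈ G.candidates S t → G.perturbedReward y t j ≤ G.perturbedReward y t i} := by
      ext y
      simp [maximizers]
    rw [heq]
    have hp : ∀ k, Measurable fun y => G.perturbedReward y t k := by
      intro k
      unfold perturbedReward
      fun_prop
    refine (MeasurableSet.const _).inter (MeasurableSet.iInter fun j => ?_)
    exact (MeasurableSet.const _).imp (measurableSet_le (hp j) (hp i))
  have hsome : ∀ i, MeasurableSet {y | G.greedyChoice y S t = some i} := by
    intro i
    have : {y | G.greedyChoice y S t = some i} =
        {y | i ∈ G.maximizers y S t} ∩ ⋂ j, {y | j ∈ G.maximizers y S t → i ≤ j} := by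
      ext y
      simp only [Set.mem_ofPred_eq, Set.mem_inter_iff, Set.mem_iInter]
      unfold greedyChoice
      constructor
      · intro h
        split_ifs at h with hne
        rw [← Option.some.inj h]
        exact ⟨Finset.min'_mem _ _, fun j hj => Finset.min'_le _ _ hj⟩
      · rintro ⟨h1, h2⟩
        rw [dif_pos ⟨i, h1⟩]
        congr 1
        exact le_antisymm (Finset.min'_le _ _ h1) (h2 _ (Finset.min'_mem _ _))
    rw [this]
    refine (hmeas i).inter (MeasurableSet.iInter fun j => ?_)
    exact (hmeas j).imp (MeasurableSet.const _)
  cases o with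
  | some i => exact hsome i
  | none =>
    have : {y | G.greedyChoice y S t = none} = (⋃ i, {y | G.greedyChoice y S t = some i})ᶜ := by
      ext y
      simp only [Set.mem_ofPred_eq, Set.mem_compl_iff, Set.mem_iUnion]
      cases G.greedyChoice y S t <;> simp
    rw [this]
    exact (MeasurableSet.iUnion hsome).compl

lemma measurable_greedyRewardFrom (G : StochasticMatching n m) (ts : List (Fin m))
    (S : Finset (Fin n)) : Measurable fun y => G.greedyRewardFrom y ts S := by
  induction ts generalizing S with
  | nil => exact measurable_const
  | cons t ts ih =>
    let F : Option (Fin n) → (Fin n → ℝ) → ℝ := fun o y =>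
      match o with
      | none => G.greedyRewardFrom y ts S
      | some i =>
        G.prob i t * (G.weight i + G.greedyRewardFrom y ts (S.erase i)) +
          (1 - G.prob i t) * G.greedyRewardFrom y ts S
    have hF : ∀ o, Measurable (F o) := by
      intro o
      cases o with
      | none => exact ih S
      | some i =>
        exact (((ih (S.erase i)).const_add _).const_mul _).add ((ih S).const_mul _)
    have : (fun y => G.greedyRewardFrom y (t :: ts) S) =
        fun y => ∑ o, if G.greedyChoice y S t = o then F o y else 0 := by
      funext y
      rw [Finset.sum_ite_eq Finset.univ (G.greedyChoice y S t) (fun o => F o y)]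
      simp only [Finset.mem_univ, if_true]
      rfl
    rw [this]
    exact Finset.measurable_fun_sum _ fun o _ =>
      Measurable.ite (G.measurableSet_greedyChoice S t o) (hF o) measurable_const

/-- The reward of Perturbed Greedy is an integrable function of the seeds. -/
theorem integrable_greedyRewardFrom (G : StochasticMatching n m) (ts : List (Fin m))
    (S : Finset (Fin n)) : Integrable (fun y => G.greedyRewardFrom y ts S) (seedLaw n) := by
  refine Integrable.of_bound (G.measurable_greedyRewardFrom ts S).aestronglyMeasurable
    (∑ i ∈ S, G.weight i) (Filter.Eventually.of_forall fun y => ?_)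
  obtain ⟨h1, h2⟩ := G.greedyRewardFrom_mem y ts S
  rwa [Real.norm_of_nonneg h1]

lemma policyValue_le (G : StochasticMatching n m) (π : OfflinePolicy n m) (S : Finset (Fin n))
    (U : Finset (Fin m)) (h : G.Feasible π S U) : G.policyValue π ≤ ∑ i ∈ S, G.weight i := by
  induction π generalizing S U with
  | finish => exact Finset.sum_nonneg fun i _ => G.weight_nonneg i
  | tryEdge i t succ fail ihs ihf =>
    obtain ⟨hS, -, hE, h1, h2⟩ := h
    have hs := Finset.add_sum_erase S G.weight hS
    have := mul_le_mul_of_nonneg_left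
      (show G.weight i + G.policyValue succ ≤ ∑ i ∈ S, G.weight i by linarith [ihs _ _ h1])
      (G.prob_nonneg i t hE)
    have := mul_le_mul_of_nonneg_left (ihf _ _ h2) (sub_nonneg.2 (G.prob_le_one i t hE))
    simp only [policyValue]
    linarith

/-- The offline optimum is a supremum of a bounded set. -/
theorem policyValue_le_offlineOpt (G : StochasticMatching n m) (π : OfflinePolicy n m)
    (h : G.Feasible π Finset.univ Finset.univ) : G.policyValue π ≤ G.offlineOpt :=
  le_csSup ⟨∑ i, G.weight i, by rintro _ ⟨π, h, rfl⟩; exact G.policyValue_le π _ _ h⟩ ⟨π, h, rfl⟩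

/-- The set of ratios is bounded below by `0`. -/
theorem perturbedGreedyRatios_nonneg {x : ℝ} (hx : x ∈ perturbedGreedyRatios) : 0 ≤ x := by
  obtain ⟨n, m, G, h, rfl⟩ := hx
  exact div_nonneg (integral_nonneg fun y => (G.greedyRewardFrom_mem y _ _).1) h.le

/-- The set of ratios is nonempty. -/
theorem perturbedGreedyRatios_nonempty : perturbedGreedyRatios.Nonempty := by
  let G : StochasticMatching 1 1 :=
    ⟨Finset.univ, fun _ => 1, fun _ _ => 1, fun _ => zero_le_one, fun _ _ _ => zero_le_one,
      fun _ _ _ => le_rfl⟩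
  refine ⟨_, 1, 1, G, ?_, rfl⟩
  have := G.policyValue_le_offlineOpt (.tryEdge 0 0 .finish .finish) (by simp [Feasible, G])
  simp only [policyValue, G] at this
  linarith

end StochasticMatching

end

/-!
One instance suffices. It has `n` unit resources, which every arrival accepts with certainty, and one
further resource `0` of weight `1 / ε` that the arrival `t` accepts with probability `ε * ρ t`. For
small `ε` an attempt on `0` is worth `ρ t` and practically never makes it unavailable. There are `2 * n`
arrivals, and `ρ t = 0` for the last `n` of them. Offline, the first `n` arrivals should go to `0`
and the last `n` to the unit resources, which earns about `n + ∑ t, ρ t`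
(`le_offlineOpt_rareResourceInstance`).

Perturbed Greedy instead spends early arrivals on unit resources, in increasing order of their seeds.
Write `v x = 1 - exp (x - 1)`. After `c` unit resources have been used up, the best unused one has a
seed close to `c / n`, and it beats the resource `0` of seed `y` as soon as `ρ t * v y < v (c / n)`.
Take `ρ t = v (t / n) / v (1 / 8)`.
* If `1 / 8 ≤ y`, then `ρ t * v y ≤ v (t / n)`, and the resource `0` is never attempted.
* If `y < 1 / 8`, then `ρ t * v y ≤ v (t / n - 1 / 8)` whenever `1 / 8 ≤ t / n`
  (`one_sub_exp_mul_le`), so that after `n / 8` attempts on `0` it is never attempted again: when an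
  attempt on `0` fails, the unit resource it spared is still there to attract a later arrival, for
  which `0` is worth less.

In both cases the number of attempts is bounded by `greedyRewardFrom_rareResourceInstance_le`. As the
unit resources are worth at most `n`, the expected reward is at most about
`n * (1 + (1 / 8) * (1 / 8) * v 0 / v (1 / 8))`, whereas the offline policy earns about
`n * (1 + exp (-1) / v (1 / 8))`, since `∫ x in 0..1, v x = exp (-1)`. The ratio of the two is about
`0.6236`. That the seeds are close to equidistributed is Hoeffding's inequality
(`seedLaw_real_card_le`); a margin `δ` in the positions `t / n` absorbs the deviations.
-/

open MeasureTheory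

noncomputable section

namespace StochasticMatching

/-! ### The instance -/

/-- The instance with `n` unit resources `1, …, n` that every arrival accepts with certainty, and one
resource `0` of large weight `ε⁻¹` that the arrival `t` accepts only with the small probability
`ε * ρ t`, so that every attempt on it is worth `ρ t` and hardly ever makes it unavailable.
There are `2 * n` arrivals. All pairs are edges; an edge of probability `0` plays the role of a
missing edge. -/
def rareResourceInstance (n : ℕ) (ρ : ℕ → ℝ) (ε : ℝ) (hε : 0 < ε) (hρ : ∀ t, 0 ≤ ρ t)
    (hρ' : ∀ t, ε * ρ t ≤ 1) : StochasticMatching (n + 1) (n + n) where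
  edges := Finset.univ
  weight i := if i = 0 then ε⁻¹ else 1
  prob i t := if i = 0 then ε * ρ t else 1
  weight_nonneg i := by split_ifs <;> positivity
  prob_nonneg i t _ := by
    have := hρ t
    split_ifs <;> positivity
  prob_le_one i t _ := by
    split_ifs
    exacts [hρ' t, le_rfl]

section Instance

variable {n : ℕ} {ρ : ℕ → ℝ} {ε : ℝ} (hε : 0 < ε) (hρ : ∀ t, 0 ≤ ρ t) (hρ' : ∀ t, ε * ρ t ≤ 1)

/-! ### Perturbed Greedy on the instance, for fixed seeds -/

/-- What the choice of Perturbed Greedy means when all pairs are edges. -/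
lemma greedyChoice_rareResourceInstance {y : Fin (n + 1) → ℝ} {S : Finset (Fin (n + 1))}
    {t : Fin (n + n)} {o : Option (Fin (n + 1))}
    (h : (rareResourceInstance n ρ ε hε hρ hρ').greedyChoice y S t = o) (hS : S.Nonempty) :
    ∃ i ∈ S, o = some i ∧
      ∀ j ∈ S, (rareResourceInstance n ρ ε hε hρ hρ').perturbedReward y t j ≤
        (rareResourceInstance n ρ ε hε hρ hρ').perturbedReward y t i := by
  set G := rareResourceInstance n ρ ε hε hρ hρ' with hG
  have hcand : G.candidates S t = S := by simp [candidates, hG, rareResourceInstance]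
  have hmax : (G.maximizers y S t).Nonempty := by
    obtain ⟨i, hi, hi'⟩ := S.exists_max_image (G.perturbedReward y t) hS
    exact ⟨i, by simp only [maximizers, hcand, Finset.mem_filter]; exact ⟨hi, hi'⟩⟩
  unfold greedyChoice at h
  rw [dif_pos hmax] at h
  have hmem := Finset.min'_mem _ hmax
  obtain ⟨i, hi⟩ : ∃ i, i = (G.maximizers y S t).min' hmax := ⟨_, rfl⟩
  rw [← hi] at hmem h
  simp only [maximizers, hcand, Finset.mem_filter] at hmem
  exact ⟨i, hmem.1, h.symm, hmem.2⟩

/-- If from the `D`-th arrival on the rare resource `0` is always beaten by so many unit resources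
that not all of them can have been used up, then it is attempted at most `D` times. As `ρ` is
antitone, these attempts are worth at most `∑ s < D, ρ s`; the unit resources are worth at most `1`
each. In a state in which `t` arrivals have departed, `t + #S - (n + 1)` of them attempted `0`. -/
lemma greedyRewardFrom_rareResourceInstance_le (hanti : Antitone ρ) {y : Fin (n + 1) → ℝ} {D : ℕ}
    (hD : ∀ t, D ≤ t → t < n + n → 0 < ρ t →
      t - D < (Finset.univ.filter fun j : Fin (n + 1) =>
        j ≠ 0 ∧ ρ t * (1 - Real.exp (y 0 - 1)) < 1 - Real.exp (y j - 1)).card)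
    (ts : List (Fin (n + n))) (t : ℕ) (S : Finset (Fin (n + 1))) (a : ℕ)
    (hts : ts.map Fin.val = List.range' t ts.length) (h0 : 0 ∈ S)
    (hcard : t + S.card = a + (n + 1)) (ha : 0 < ρ t → a ≤ D) :
    (rareResourceInstance n ρ ε hε hρ hρ').greedyRewardFrom y ts S ≤
      (S.card : ℝ) - 1 + ∑ s ∈ Finset.Ico a D, ρ s := by
  set G := rareResourceInstance n ρ ε hε hρ hρ' with hG
  have hw0 : G.weight 0 = ε⁻¹ := by simp [hG, rareResourceInstance]
  have hw1 : ∀ j, j ≠ 0 → G.weight j = 1 := by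
    intro j hj; simp [hG, rareResourceInstance, hj]
  have hp0 : ∀ t, G.prob 0 t = ε * ρ t := by simp [hG, rareResourceInstance]
  have hp1 : ∀ j t, j ≠ 0 → G.prob j t = 1 := by
    intro j t hj; simp [hG, rareResourceInstance, hj]
  have hsum : ∀ a, 0 ≤ ∑ s ∈ Finset.Ico a D, ρ s := fun a => Finset.sum_nonneg fun s _ => hρ s
  induction ts generalizing t S a with
  | nil =>
    have : (1 : ℝ) ≤ S.card := by exact_mod_cast Finset.card_pos.2 ⟨0, h0⟩
    have := hsum a
    simp only [greedyRewardFrom]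
    linarith
  | cons u us ih =>
    simp only [List.map_cons, List.length_cons, List.range'_succ, List.cons.injEq] at hts
    obtain ⟨hu, hus⟩ := hts
    have hle : S.card ≤ n + 1 := by simpa using S.card_le_univ
    have hat : a ≤ t := by omega
    obtain ⟨i, hiS, hi, hmax⟩ := greedyChoice_rareResourceInstance hε hρ hρ'
      (y := y) (t := u) (o := G.greedyChoice y S u) rfl ⟨0, h0⟩
    unfold greedyRewardFrom
    rw [hi]
    simp only
    by_cases hi0 : i = 0
    · subst hi0
      have haD : 0 < ρ t → a < D := by
        intro hpos
        by_contra hlt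
        have haD' : a = D := le_antisymm (ha hpos) (not_lt.1 hlt)
        -- The unit resources that beat `0` outnumber those that have been used up.
        have hlt' := hD t (by omega) (by omega) hpos
        have hex : ∃ j ∈ S, j ≠ 0 ∧
            ρ t * (1 - Real.exp (y 0 - 1)) < 1 - Real.exp (y j - 1) := by
          by_contra hno
          push Not at hno
          have hsub : (Finset.univ.filter fun j : Fin (n + 1) =>
              j ≠ 0 ∧ ρ t * (1 - Real.exp (y 0 - 1)) < 1 - Real.exp (y j - 1)) ⊆ Sᶜ := by
            intro j hj
            simp only [Finset.mem_filter, Finset.mem_univ, true_and] at hj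
            simp only [Finset.mem_compl]
            intro hjS
            exact absurd hj.2 (not_lt.2 (hno j hjS hj.1))
          have := Finset.card_le_card hsub
          rw [Finset.card_compl, Fintype.card_fin] at this
          omega
        obtain ⟨j, hjS, hj0, hj⟩ := hex
        have := hmax j hjS
        rw [← hG] at this
        simp only [perturbedReward, hw0, hw1 j hj0, hp0, hp1 j u hj0, hu] at this
        rw [mul_right_comm ε, mul_inv_cancel₀ hε.ne'] at this
        linarith
      have hfail := ih (t + 1) S (a + 1) hus h0 (by omega) fun hpos =>
        haD (hpos.trans_le (hanti (Nat.le_succ t)))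
      have hsucc := (G.greedyRewardFrom_mem y us (S.erase 0)).2
      have hones : ∑ i ∈ S.erase 0, G.weight i = (S.card : ℝ) - 1 := by
        rw [Finset.sum_congr rfl fun j hj => hw1 j (Finset.ne_of_mem_erase hj)]
        simp [Finset.card_erase_of_mem h0, Nat.cast_sub (Finset.card_pos.2 ⟨0, h0⟩)]
      rw [hones] at hsucc
      have hp : 0 ≤ ε * ρ t := mul_nonneg hε.le (hρ t)
      have hρa : ρ t + ∑ s ∈ Finset.Ico (a + 1) D, ρ s ≤ ∑ s ∈ Finset.Ico a D, ρ s := by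
        rcases (hρ t).eq_or_lt with h | h
        · rw [← h, zero_add]
          exact Finset.sum_le_sum_of_subset_of_nonneg (Finset.Ico_subset_Ico (by omega) le_rfl)
            fun s _ _ => hρ s
        · rw [Finset.sum_eq_sum_Ico_succ_bot (haD h)]
          linarith [hanti hat]
      have h1 := hsum (a + 1)
      rw [hw0, hp0, hu]
      have e1 : ε * ρ t * ε⁻¹ = ρ t := by field_simp
      have := mul_le_mul_of_nonneg_left hsucc hp
      have := mul_le_mul_of_nonneg_left hfail (sub_nonneg.2 (hρ' t))
      have := mul_nonneg hp h1
      nlinarith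
    · have hS : (S.erase i).card + 1 = S.card := Finset.card_erase_add_one hiS
      have := ih (t + 1) (S.erase i) a hus (by simp [h0, Ne.symm hi0]) (by omega)
        fun h => ha (h.trans_le (hanti (Nat.le_succ t)))
      rw [hw1 i hi0, hp1 i u hi0]
      have hS' : ((S.erase i).card : ℝ) + 1 = S.card := by exact_mod_cast hS
      linarith

end Instance

/-! ### An offline policy -/

/-- Match the unit resources `j + 1`, for `j` in the list, to the late arrivals `n + j`. -/
def unitPolicy (n : ℕ) : List (Fin n) → OfflinePolicy (n + 1) (n + n)
  | [] => .finish
  | j :: js => .tryEdge j.succ (Fin.natAdd n j) (unitPolicy n js) (unitPolicy n js)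

/-- Offer the arrivals in the list, which are among the first `n`, to the resource `0` until it
succeeds, and then match all unit resources to the late arrivals. -/
def rareThenUnitPolicy (n : ℕ) : List (Fin n) → OfflinePolicy (n + 1) (n + n)
  | [] => unitPolicy n (List.finRange n)
  | t :: ts => .tryEdge 0 (Fin.castAdd n t) (unitPolicy n (List.finRange n))
      (rareThenUnitPolicy n ts)

section Instance

variable {n : ℕ} {ρ : ℕ → ℝ} {ε : ℝ} (hε : 0 < ε) (hρ : ∀ t, 0 ≤ ρ t) (hρ' : ∀ t, ε * ρ t ≤ 1)

lemma feasible_unitPolicy (js : List (Fin n)) (hjs : js.Nodup) (S : Finset (Fin (n + 1)))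
    (U : Finset (Fin (n + n))) (hS : ∀ j ∈ js, j.succ ∈ S) (hU : ∀ j ∈ js, Fin.natAdd n j ∈ U) :
    (rareResourceInstance n ρ ε hε hρ hρ').Feasible (unitPolicy n js) S U := by
  induction js generalizing S U with
  | nil => trivial
  | cons j js ih =>
    rw [List.nodup_cons] at hjs
    have hne : ∀ k ∈ js, k ≠ j := fun k hk h => hjs.1 (h ▸ hk)
    have hU' : ∀ k ∈ js, Fin.natAdd n k ∈ U.erase (Fin.natAdd n j) := fun k hk =>
      Finset.mem_erase.2 ⟨by simpa using hne k hk, hU k (List.mem_cons_of_mem _ hk)⟩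
    refine ⟨hS j List.mem_cons_self, hU j List.mem_cons_self, Finset.mem_univ _,
      ih hjs.2 _ _ (fun k hk => ?_) hU',
      ih hjs.2 _ _ (fun k hk => hS k (List.mem_cons_of_mem _ hk)) hU'⟩
    exact Finset.mem_erase.2 ⟨by simpa using hne k hk, hS k (List.mem_cons_of_mem _ hk)⟩

lemma feasible_rareThenUnitPolicy (ts : List (Fin n)) (hts : ts.Nodup) (U : Finset (Fin (n + n)))
    (hU : ∀ t ∈ ts, Fin.castAdd n t ∈ U) (hU' : ∀ j, Fin.natAdd n j ∈ U) :
    (rareResourceInstance n ρ ε hε hρ hρ').Feasible (rareThenUnitPolicy n ts) Finset.univ U := by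
  have hne : ∀ j t : Fin n, Fin.natAdd n j ≠ Fin.castAdd n t := by
    intro j t h
    have := congrArg Fin.val h
    simp only [Fin.val_natAdd, Fin.val_castAdd] at this
    omega
  induction ts generalizing U with
  | nil =>
    exact feasible_unitPolicy hε hρ hρ' _ (List.nodup_finRange n) _ _ (fun j _ => Finset.mem_univ _)
      fun j _ => hU' j
  | cons t ts ih =>
    rw [List.nodup_cons] at hts
    refine ⟨Finset.mem_univ _, hU t List.mem_cons_self, Finset.mem_univ _, ?_, ?_⟩
    · exact feasible_unitPolicy hε hρ hρ' _ (List.nodup_finRange n) _ _ (fun j _ => by simp)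
        fun j _ => Finset.mem_erase.2 ⟨hne j t, hU' j⟩
    · refine ih hts.2 _ (fun s hs => Finset.mem_erase.2 ⟨?_, hU s (List.mem_cons_of_mem _ hs)⟩)
        fun j => Finset.mem_erase.2 ⟨hne j t, hU' j⟩
      intro h
      exact hts.1 (Fin.castAdd_injective n n h ▸ hs)

lemma policyValue_unitPolicy (js : List (Fin n)) :
    (rareResourceInstance n ρ ε hε hρ hρ').policyValue (unitPolicy n js) = js.length := by
  induction js with
  | nil => simp [unitPolicy, policyValue]
  | cons j js ih =>
    simp only [unitPolicy, policyValue, ih]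
    simp [rareResourceInstance, Fin.succ_ne_zero, add_comm]

/-- An attempt on the resource `0` is worth `ρ t` if `0` is still available, and `0` is lost with
probability at most `ε * ∑ ρ`. -/
lemma policyValue_rareThenUnitPolicy (ts : List (Fin n)) :
    (n : ℝ) + (ts.map fun t : Fin n => ρ t).sum - ε * (ts.map fun t : Fin n => ρ t).sum ^ 2 ≤
        (rareResourceInstance n ρ ε hε hρ hρ').policyValue (rareThenUnitPolicy n ts) ∧
      (rareResourceInstance n ρ ε hε hρ hρ').policyValue (rareThenUnitPolicy n ts) ≤
        n + (ts.map fun t : Fin n => ρ t).sum := by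
  induction ts with
  | nil =>
    simp only [rareThenUnitPolicy, policyValue_unitPolicy]
    simp
  | cons t ts ih =>
    simp only [rareThenUnitPolicy, policyValue, policyValue_unitPolicy, List.length_finRange]
    have hw : (rareResourceInstance n ρ ε hε hρ hρ').weight 0 = ε⁻¹ := by
      simp [rareResourceInstance]
    have hp : (rareResourceInstance n ρ ε hε hρ hρ').prob 0 (Fin.castAdd n t) = ε * ρ t := by
      simp [rareResourceInstance]
    rw [hw, hp, List.map_cons, List.sum_cons]
    set s := (ts.map fun t : Fin n => ρ t).sum with hs
    set V := (rareResourceInstance n ρ ε hε hρ hρ').policyValue (rareThenUnitPolicy n ts) with hV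
    obtain ⟨h1, h2⟩ := ih
    have hs0 : 0 ≤ s := List.sum_nonneg fun x hx => by
      obtain ⟨t, -, rfl⟩ := List.mem_map.1 hx
      exact hρ t
    have e : ε * ρ t * (ε⁻¹ + n) + (1 - ε * ρ t) * V = ρ t + V - ε * ρ t * (V - n) := by
      field_simp
      ring
    have hq : 0 ≤ ε * ρ t := mul_nonneg hε.le (hρ t)
    have hq' : 0 ≤ ε * ρ t * ρ t := mul_nonneg hq (hρ t)
    have h3 := mul_le_mul_of_nonneg_left h2 hq
    have h4 := mul_le_mul_of_nonneg_left h2 (sub_nonneg.2 (hρ' t))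
    have h5 := mul_nonneg hq hs0
    rw [e]
    constructor
    · nlinarith
    · nlinarith

theorem le_offlineOpt_rareResourceInstance :
    (n : ℝ) + ∑ t ∈ Finset.range n, ρ t - ε * (∑ t ∈ Finset.range n, ρ t) ^ 2 ≤
      (rareResourceInstance n ρ ε hε hρ hρ').offlineOpt := by
  have h := (rareResourceInstance n ρ ε hε hρ hρ').policyValue_le_offlineOpt _
    (feasible_rareThenUnitPolicy hε hρ hρ' (List.finRange n) (List.nodup_finRange n) _
      (fun _ _ => Finset.mem_univ _) fun _ => Finset.mem_univ _)
  have hs : ((List.finRange n).map fun t : Fin n => ρ t).sum = ∑ t ∈ Finset.range n, ρ t := by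
    rw [← Fin.sum_univ_def, Finset.sum_range]
  have h' := (policyValue_rareThenUnitPolicy hε hρ hρ' (List.finRange n)).1
  rw [hs] at h'
  exact h'.trans h

end Instance

/-! ### The seeds -/

lemma seedLaw_eval_preimage {n : ℕ} (i : Fin n) {s : Set ℝ} (hs : MeasurableSet s) :
    seedLaw n {y | y i ∈ s} = volume (s ∩ Set.Icc 0 1) := by
  have : IsProbabilityMeasure (volume.restrict (Set.Icc (0 : ℝ) 1)) := ⟨by simp⟩
  have h := (measurePreserving_eval (fun _ : Fin n => volume.restrict (Set.Icc (0 : ℝ) 1)) i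
    ).measure_preimage hs.nullMeasurableSet
  rw [Measure.restrict_apply hs] at h
  exact h

lemma seedLaw_real_lt {n : ℕ} (i : Fin n) {z : ℝ} (h0 : 0 ≤ z) (h1 : z ≤ 1) :
    (seedLaw n).real {y | y i < z} = z := by
  have h := seedLaw_eval_preimage i (measurableSet_Iio (a := z))
  have : Set.Iio z ∩ Set.Icc 0 1 = Set.Ico 0 z := by
    ext x
    simp only [Set.mem_inter_iff, Set.mem_Iio, Set.mem_Icc, Set.mem_Ico]
    constructor
    · rintro ⟨h1, h2, h3⟩; exact ⟨h2, h1⟩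
    · rintro ⟨h2, h3⟩; exact ⟨h3, h2, by linarith⟩
  rw [this, Real.volume_Ico, sub_zero] at h
  rw [Measure.real]
  change (seedLaw n {y | y i ∈ Set.Iio z}).toReal = z
  rw [h, ENNReal.toReal_ofReal h0]

lemma seedLaw_ae_nonneg {n : ℕ} (i : Fin n) : ∀ᵐ y ∂seedLaw n, 0 ≤ y i := by
  have h := seedLaw_eval_preimage i (measurableSet_Iio (a := (0 : ℝ)))
  have h' : Set.Iio (0 : ℝ) ∩ Set.Icc 0 1 = ∅ := by
    ext x
    simp only [Set.mem_inter_iff, Set.mem_Iio, Set.mem_Icc, Set.mem_empty_iff_false, iff_false]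
    rintro ⟨h1, h2, -⟩
    linarith
  rw [h', measure_empty] at h
  rw [ae_iff]
  simpa using h

/-- Hoeffding's inequality for the number of seeds below `z`. -/
lemma seedLaw_real_card_le {n : ℕ} (J : Finset (Fin n)) {z δ : ℝ} (h0 : 0 ≤ z) (h1 : z ≤ 1)
    (hδ : 0 ≤ δ) :
    (seedLaw n).real {y | ((J.filter fun j => y j < z).card : ℝ) ≤ J.card * (z - δ)} ≤
      Real.exp (-2 * J.card * δ ^ 2) := by
  have : IsProbabilityMeasure (volume.restrict (Set.Icc (0 : ℝ) 1)) := ⟨by simp⟩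
  classical
  let f : ℝ → ℝ := (Set.Iio z).indicator fun _ => -1
  have hf : Measurable f := measurable_const.indicator measurableSet_Iio
  have hint : ∀ j, ∫ y, f (y j) ∂seedLaw n = -z := by
    intro j
    have : (fun y : Fin n → ℝ => f (y j)) = {y | y j < z}.indicator fun _ => -1 := by
      ext y
      simp [f, Set.indicator_apply]
    rw [this, integral_indicator_const _ (measurableSet_lt (measurable_pi_apply j) measurable_const),
      seedLaw_real_lt j h0 h1]
    simp
  have hind : ProbabilityTheory.iIndepFun (fun j (y : Fin n → ℝ) => f (y j) - -z) (seedLaw n) :=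
    ProbabilityTheory.iIndepFun_pi (X := fun _ x => f x - -z)
      fun _ => (hf.sub_const _).aemeasurable
  have hsub : ∀ j ∈ J, ProbabilityTheory.HasSubgaussianMGF
      (fun y : Fin n → ℝ => f (y j) - -z) ((‖(0 : ℝ) - (-1)‖₊ / 2) ^ 2) (seedLaw n) := by
    intro j _
    have := ProbabilityTheory.hasSubgaussianMGF_of_mem_Icc (μ := seedLaw n)
      (X := fun y : Fin n → ℝ => f (y j)) (a := -1) (b := 0)
      (hf.comp (measurable_pi_apply j)).aemeasurable
      (Filter.Eventually.of_forall fun y => by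
        simp only [f, Set.indicator_apply]
        split_ifs <;> simp)
    rwa [hint j] at this
  have h := ProbabilityTheory.HasSubgaussianMGF.measure_sum_ge_le_of_iIndepFun hind hsub
    (ε := J.card * δ) (by positivity)
  have hset : {y : Fin n → ℝ | ((J.filter fun j => y j < z).card : ℝ) ≤ J.card * (z - δ)} =
      {y | J.card * δ ≤ ∑ j ∈ J, (f (y j) - -z)} := by
    ext y
    have : ∑ j ∈ J, (f (y j) - -z) = J.card * z - (J.filter fun j => y j < z).card := by
      have hf' : ∀ j, f (y j) = -(if y j < z then 1 else 0) := by
        intro j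
        simp only [f, Set.indicator_apply, Set.mem_Iio]
        split_ifs <;> simp
      simp only [Finset.sum_sub_distrib, hf', Finset.sum_neg_distrib, Finset.sum_boole,
        Finset.sum_const, nsmul_eq_mul]
      ring
    simp only [Set.mem_ofPred_eq, this]
    constructor <;> intro h <;> linarith
  rw [hset]
  refine h.trans (Real.exp_le_exp.2 ?_)
  rcases J.eq_empty_or_nonempty with rfl | hJ
  · simp
  · have : (0 : ℝ) < J.card := by exact_mod_cast hJ.card_pos
    simp
    field_simp
    norm_num

/-! ### The values of the attempts -/

lemma exp_neg_seven_eighths_bounds : 0.4168 < Real.exp (1 / 8 - 1) ∧ Real.exp (1 / 8 - 1) < 1 / 2 := by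
  have h8 : Real.exp (1 / 8 - 1) ^ 8 = Real.exp (-1) ^ 7 := by
    rw [← Real.exp_nat_mul, ← Real.exp_nat_mul]
    norm_num
  have hl := Real.exp_neg_one_gt_d9
  have hu := Real.exp_neg_one_lt_d9
  constructor
  · refine lt_of_pow_lt_pow_left₀ 8 (Real.exp_pos _).le ?_
    rw [h8]
    refine lt_of_lt_of_le ?_ (pow_le_pow_left₀ (by norm_num) hl.le 7)
    norm_num
  · refine lt_of_pow_lt_pow_left₀ 8 (by norm_num) ?_
    rw [h8]
    refine lt_of_le_of_lt (pow_le_pow_left₀ (Real.exp_pos _).le hu.le 7) ?_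
    norm_num

/-- The position of the arrival `t` on the scale of the seeds. After `t` unit resources have been
used up, there is with high probability an unused one whose seed is less than `position n δ t`. -/
def position (n : ℕ) (δ : ℝ) (t : ℕ) : ℝ := (t + 1) / n + δ

/-- The expected reward `ρ t` of an attempt of the arrival `t` on the rare resource, proportional to
`1 - exp (position n δ t - 1)` and scaled such that a rare resource of seed `1 / 8` is as good as a
unit resource of seed `position n δ t`. -/
def attemptValue (n : ℕ) (δ : ℝ) (t : ℕ) : ℝ :=
  max 0 (1 - Real.exp (position n δ t - 1)) / (1 - Real.exp (1 / 8 - 1))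

variable {n : ℕ} {δ : ℝ}

lemma one_sub_exp_pos : 0 < 1 - Real.exp (1 / 8 - 1) := by
  linarith [exp_neg_seven_eighths_bounds.2]

lemma attemptValue_nonneg (t : ℕ) : 0 ≤ attemptValue n δ t :=
  div_nonneg (le_max_left _ _) one_sub_exp_pos.le

lemma antitone_attemptValue : Antitone (attemptValue n δ) := by
  intro s t hst
  have := one_sub_exp_pos
  unfold attemptValue position
  gcongr

lemma attemptValue_le (hδ : 0 ≤ δ) (t : ℕ) :
    attemptValue n δ t ≤ (1 - Real.exp (-1)) / (1 - Real.exp (1 / 8 - 1)) := by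
  have := one_sub_exp_pos
  unfold attemptValue
  gcongr
  refine max_le (sub_nonneg.2 (Real.exp_le_one_iff.2 (by norm_num))) ?_
  gcongr
  have : 0 ≤ position n δ t := by unfold position; positivity
  linarith

lemma attemptValue_le_two (hδ : 0 ≤ δ) (t : ℕ) : attemptValue n δ t ≤ 2 := by
  refine (attemptValue_le hδ t).trans ?_
  rw [div_le_iff₀ one_sub_exp_pos]
  linarith [exp_neg_seven_eighths_bounds.2, Real.exp_pos (-1)]

lemma position_lt_one_of_attemptValue_pos {t : ℕ} (h : 0 < attemptValue n δ t) :
    position n δ t < 1 ∧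
      attemptValue n δ t * (1 - Real.exp (1 / 8 - 1)) = 1 - Real.exp (position n δ t - 1) := by
  unfold attemptValue at h ⊢
  rw [div_mul_cancel₀ _ one_sub_exp_pos.ne']
  have h' : 0 < 1 - Real.exp (position n δ t - 1) := by
    by_contra hle
    rw [max_eq_left (not_lt.1 hle), zero_div] at h
    exact h.false
  refine ⟨?_, max_eq_right h'.le⟩
  have := Real.exp_lt_one_iff.1 (sub_pos.1 h')
  linarith

/-- The ratio of `1 - exp (x - 1)` to `1 - exp (x - 1 / 8 - 1)` is largest at `x = 1 / 8`. -/
lemma one_sub_exp_mul_le {x : ℝ} (hx : 1 / 8 ≤ x) :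
    (1 - Real.exp (x - 1)) * (1 - Real.exp (-1)) ≤
      (1 - Real.exp (x - 1 / 8 - 1)) * (1 - Real.exp (1 / 8 - 1)) := by
  have e1 : Real.exp (x - 1) = Real.exp (x - 1 / 8 - 1) * Real.exp (1 / 8) := by
    rw [← Real.exp_add]; ring_nf
  have e2 : Real.exp (1 / 8 - 1) = Real.exp (-1) * Real.exp (1 / 8) := by
    rw [← Real.exp_add]; ring_nf
  have h1 : 1 ≤ Real.exp (1 / 8) := Real.one_le_exp (by norm_num)
  have h2 : Real.exp (-1) ≤ Real.exp (x - 1 / 8 - 1) := Real.exp_le_exp.2 (by linarith)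
  rw [e1, e2]
  nlinarith [mul_nonneg (sub_nonneg.2 h1) (sub_nonneg.2 h2)]

/-- A Riemann sum for `∫ x in 0..1, (1 - exp (x - 1)) = exp (-1)`, with primitive
`x - exp (x - 1)`. -/
lemma le_sum_attemptValue (hn : 0 < n) (hδ : 0 ≤ δ) (hη : 1 / (n : ℝ) + δ ≤ 1 / 2) :
    n * (Real.exp (-1) - 2 * (1 / n + δ)) / (1 - Real.exp (1 / 8 - 1)) ≤
      ∑ t ∈ Finset.range n, attemptValue n δ t := by
  have hn' : (0 : ℝ) < n := by exact_mod_cast hn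
  let P : ℕ → ℝ := fun t => position n δ t - Real.exp (position n δ t - 1)
  have hstep : ∀ t, n * (P (t + 1) - P t) ≤ max 0 (1 - Real.exp (position n δ t - 1)) := by
    intro t
    have hp : position n δ (t + 1) = position n δ t + 1 / n := by
      unfold position; push_cast; field_simp; ring
    have hexp : Real.exp (position n δ t - 1) * (1 + 1 / n) ≤
        Real.exp (position n δ (t + 1) - 1) := by
      have : position n δ (t + 1) - 1 = (position n δ t - 1) + 1 / n := by rw [hp]; ring
      rw [this, Real.exp_add]
      gcongr
      linarith [Real.add_one_le_exp (1 / (n : ℝ))]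
    refine le_trans ?_ (le_max_right _ _)
    have : P (t + 1) - P t ≤ 1 / n * (1 - Real.exp (position n δ t - 1)) := by
      simp only [P]
      linarith
    calc n * (P (t + 1) - P t) ≤ n * (1 / n * (1 - Real.exp (position n δ t - 1))) := by gcongr
      _ = _ := by field_simp
  have htel : n * (P n - P 0) ≤
      ∑ t ∈ Finset.range n, max 0 (1 - Real.exp (position n δ t - 1)) := by
    rw [← Finset.sum_range_sub P n, Finset.mul_sum]
    exact Finset.sum_le_sum fun t _ => hstep t
  have hP : Real.exp (-1) - 2 * (1 / n + δ) ≤ P n - P 0 := by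
    set η := 1 / (n : ℝ) + δ with hηd
    have hη0 : 0 ≤ η := by positivity
    have h0 : position n δ 0 = η := by simp [position, hηd]
    have h1 : position n δ n = 1 + η := by
      unfold position; rw [hηd]; field_simp; ring
    have e : Real.exp (η - 1) = Real.exp η * Real.exp (-1) := by rw [← Real.exp_add]; ring_nf
    have hle : Real.exp η ≤ 1 + 2 * η := by
      have h2 := Real.add_one_le_exp (-η)
      have h3 : Real.exp η * Real.exp (-η) = 1 := by rw [← Real.exp_add]; simp
      have h4 := mul_le_mul_of_nonneg_left h2 (Real.exp_pos η).le
      have h5 : 1 ≤ (1 + 2 * η) * (-η + 1) := by nlinarith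
      by_contra hlt
      nlinarith
    have hlt : Real.exp (-1) < 1 := Real.exp_lt_one_iff.2 (by norm_num)
    have h1e : 1 ≤ Real.exp η := Real.one_le_exp hη0
    simp only [P, h0, h1, add_sub_cancel_left, e]
    nlinarith [mul_nonneg (Real.exp_pos (-1)).le (sub_nonneg.2 h1e)]
  unfold attemptValue
  rw [← Finset.sum_div]
  have := one_sub_exp_pos
  gcongr
  exact (mul_le_mul_of_nonneg_left hP hn'.le).trans htel

/-! ### The expected reward of Perturbed Greedy on the instance -/

/-- The seeds for which, for some `t`, only `t` unit resources or fewer have a seed less than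
`position n δ t`. -/
def atypicalSeeds (n : ℕ) (δ : ℝ) : Set (Fin (n + 1) → ℝ) :=
  ⋃ t ∈ (Finset.range n).filter fun t => position n δ t < 1,
    {y | (((Finset.univ.erase 0).filter fun j => y j < position n δ t).card : ℝ) ≤
      (Finset.univ.erase (0 : Fin (n + 1))).card * (position n δ t - δ)}

lemma seedLaw_real_atypicalSeeds_le (hn : 0 < n) (hδ : 0 ≤ δ) :
    (seedLaw (n + 1)).real (atypicalSeeds n δ) ≤ n * Real.exp (-2 * n * δ ^ 2) := by
  refine (measureReal_biUnion_finset_le _ _).trans ?_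
  refine (Finset.sum_le_card_nsmul _ _ (Real.exp (-2 * n * δ ^ 2)) fun t ht => ?_).trans ?_
  · have h0 : 0 ≤ position n δ t := by unfold position; positivity
    have := seedLaw_real_card_le (Finset.univ.erase (0 : Fin (n + 1))) h0
      (Finset.mem_filter.1 ht).2.le hδ
    simpa using this
  · rw [nsmul_eq_mul]
    gcongr
    exact_mod_cast (Finset.card_filter_le _ _).trans (by simp)

/-- For typical seeds and as long as an attempt on the rare resource has positive value, more than
`t` unit resources have a seed less than `position n δ t`. -/
lemma lt_card_of_notMem_atypicalSeeds (hn : 0 < n) (hδ : 0 ≤ δ) {y : Fin (n + 1) → ℝ}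
    (hy : y ∉ atypicalSeeds n δ) {t : ℕ} (ht : position n δ t < 1) {x : ℝ}
    (hx : x ≤ 1 - Real.exp (position n δ t - 1)) :
    t < (Finset.univ.filter fun j : Fin (n + 1) => j ≠ 0 ∧ x < 1 - Real.exp (y j - 1)).card := by
  have hn' : (0 : ℝ) < n := by exact_mod_cast hn
  have htn : t < n := by
    unfold position at ht
    have : ((t : ℝ) + 1) / n < 1 := by linarith
    rw [div_lt_one hn'] at this
    exact_mod_cast (show (t : ℝ) < n by linarith)
  simp only [atypicalSeeds, Set.mem_iUnion, not_exists] at hy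
  have := hy t (Finset.mem_filter.2 ⟨Finset.mem_range.2 htn, ht⟩)
  simp only [Set.mem_ofPred_eq, not_le] at this
  have hpos : (n : ℝ) * (position n δ t - δ) = t + 1 := by
    unfold position; field_simp; ring
  rw [Finset.card_erase_of_mem (Finset.mem_univ _), Finset.card_univ, Fintype.card_fin,
    Nat.add_sub_cancel, hpos] at this
  have hsub : ((Finset.univ.erase (0 : Fin (n + 1))).filter fun j => y j < position n δ t) ⊆
      Finset.univ.filter fun j : Fin (n + 1) => j ≠ 0 ∧ x < 1 - Real.exp (y j - 1) := by
    intro j hj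
    simp only [Finset.mem_filter, Finset.mem_erase, Finset.mem_univ, and_true, true_and] at hj ⊢
    refine ⟨hj.1, hx.trans_lt ?_⟩
    have := Real.exp_lt_exp.2 (show y j - 1 < position n δ t - 1 by linarith [hj.2])
    linarith
  have h2 := Finset.card_le_card hsub
  have h3 : t + 1 < ((Finset.univ.erase (0 : Fin (n + 1))).filter
      fun j => y j < position n δ t).card := by exact_mod_cast this
  omega

lemma one_div_sq_mul_attemptValue_le_one (hn : 2 ≤ n) (hδ : 0 ≤ δ) (t : ℕ) :
    1 / (n : ℝ) ^ 2 * attemptValue n δ t ≤ 1 := by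
  have h2 : (2 : ℝ) ≤ n := by exact_mod_cast hn
  have := attemptValue_le_two (n := n) hδ t
  rw [one_div_mul_eq_div, div_le_one (by positivity)]
  nlinarith

/-- The instance with the attempt values `attemptValue n δ` and the weight `n ^ 2` of the rare
resource. -/
def hardInstance (n : ℕ) (δ : ℝ) (hn : 2 ≤ n) (hδ : 0 ≤ δ) : StochasticMatching (n + 1) (n + n) :=
  rareResourceInstance n (attemptValue n δ) (1 / (n : ℝ) ^ 2) (by positivity) attemptValue_nonneg
    (one_div_sq_mul_attemptValue_le_one hn hδ)

lemma greedyRewardFrom_hardInstance_le (hn : 2 ≤ n) (hδ : 0 ≤ δ) {y : Fin (n + 1) → ℝ} {D : ℕ}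
    (hD : ∀ t, D ≤ t → t < n + n → 0 < attemptValue n δ t →
      t - D < (Finset.univ.filter fun j : Fin (n + 1) =>
        j ≠ 0 ∧ attemptValue n δ t * (1 - Real.exp (y 0 - 1)) < 1 - Real.exp (y j - 1)).card) :
    (hardInstance n δ hn hδ).greedyRewardFrom y (List.finRange (n + n)) Finset.univ ≤
      n + D * attemptValue n δ 0 := by
  have h := greedyRewardFrom_rareResourceInstance_le (n := n) (ε := 1 / (n : ℝ) ^ 2)
    (by positivity) attemptValue_nonneg
    (one_div_sq_mul_attemptValue_le_one hn hδ) antitone_attemptValue hD (List.finRange (n + n)) 0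
    Finset.univ 0 (by rw [List.map_coe_finRange_eq_range, List.range_eq_range', List.length_finRange])
    (Finset.mem_univ _) (by simp) fun _ => Nat.zero_le D
  refine h.trans ?_
  have hsum : ∑ s ∈ Finset.Ico 0 D, attemptValue n δ s ≤ D * attemptValue n δ 0 := by
    have := Finset.sum_le_card_nsmul (Finset.Ico 0 D) (attemptValue n δ) (attemptValue n δ 0)
      fun s _ => antitone_attemptValue (Nat.zero_le s)
    simpa using this
  simp only [Finset.card_univ, Fintype.card_fin]
  push_cast
  linarith

/-- For typical seeds the rare resource is never attempted if its seed is at least `1 / 8`, and at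
most `n / 8` times otherwise. -/
lemma perturbedGreedy_hardInstance_le {k : ℕ} (hk : n = 8 * k) (hn : 2 ≤ n) (hδ : 0 ≤ δ) :
    (hardInstance n δ hn hδ).perturbedGreedy ≤ n + k * attemptValue n δ 0 * (1 / 8) +
      2 * n * attemptValue n δ 0 * (n * Real.exp (-2 * n * δ ^ 2)) := by
  have hn0 : 0 < n := by omega
  have hk0 : (0 : ℝ) < k := by
    have : 0 < k := by omega
    exact_mod_cast this
  set A := attemptValue n δ 0 with hA
  have hA0 : 0 ≤ A := attemptValue_nonneg 0
  have hm1 : MeasurableSet {y : Fin (n + 1) → ℝ | y 0 < 1 / 8} :=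
    measurableSet_lt (measurable_pi_apply 0) measurable_const
  have hm2 : MeasurableSet (atypicalSeeds n δ) := by
    refine Finset.measurableSet_biUnion _ fun t _ => ?_
    have : ∀ y : Fin (n + 1) → ℝ,
        (((Finset.univ.erase 0).filter fun j => y j < position n δ t).card : ℝ) =
          ∑ j ∈ Finset.univ.erase 0, {y : Fin (n + 1) → ℝ | y j < position n δ t}.indicator 1 y := by
      intro y
      rw [Finset.card_filter]
      push_cast
      exact Finset.sum_congr rfl fun j _ => by simp [Set.indicator_apply]
    simp only [this]
    refine measurableSet_le (Finset.measurable_fun_sum _ fun j _ => ?_) measurable_const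
    exact measurable_one.indicator (measurableSet_lt (measurable_pi_apply j) measurable_const)
  let F : (Fin (n + 1) → ℝ) → ℝ := (fun _ => (n : ℝ)) +
    {y : Fin (n + 1) → ℝ | y 0 < 1 / 8}.indicator (fun _ => k * A) +
    (atypicalSeeds n δ).indicator (fun _ => 2 * n * A)
  have hle : ∀ᵐ y ∂seedLaw (n + 1), (hardInstance n δ hn hδ).greedyRewardFrom y
      (List.finRange (n + n)) Finset.univ ≤ F y := by
    filter_upwards [seedLaw_ae_nonneg (0 : Fin (n + 1))] with y hy0
    have hV := one_sub_exp_pos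
    by_cases hbad : y ∈ atypicalSeeds n δ
    · -- There are only `n + n` arrivals, so this bound holds for all seeds.
      have := greedyRewardFrom_hardInstance_le hn hδ (y := y) (D := n + n)
        fun t h1 h2 => absurd h1 (not_le.2 h2)
      have h0 : 0 ≤ {y : Fin (n + 1) → ℝ | y 0 < 1 / 8}.indicator (fun _ => k * A) y :=
        Set.indicator_nonneg (fun _ _ => by positivity) _
      simp only [F, Pi.add_apply, Set.indicator_of_mem hbad]
      push_cast at this
      linarith
    · by_cases hy8 : y 0 < 1 / 8
      · have := greedyRewardFrom_hardInstance_le hn hδ (y := y) (D := k) fun t hkt _ hpos => by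
          obtain ⟨ht1, ht2⟩ := position_lt_one_of_attemptValue_pos hpos
          have hshift : position n δ (t - k) = position n δ t - 1 / 8 := by
            unfold position
            rw [hk]
            push_cast [Nat.cast_sub hkt]
            field_simp
            ring
          refine lt_card_of_notMem_atypicalSeeds hn0 hδ hbad (by rw [hshift]; linarith) ?_
          have h8 : 1 / 8 ≤ position n δ t := by
            have : 0 ≤ position n δ (t - k) := by unfold position; positivity
            linarith
          have hmul := one_sub_exp_mul_le h8
          rw [← ht2] at hmul
          have hy : 1 - Real.exp (y 0 - 1) ≤ 1 - Real.exp (-1) := by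
            have := Real.exp_le_exp.2 (show -1 ≤ y 0 - 1 by linarith)
            linarith
          rw [hshift]
          have := mul_le_mul_of_nonneg_left hy hpos.le
          refine this.trans (le_of_mul_le_mul_right ?_ hV)
          linarith
        simp only [F, Pi.add_apply, Set.indicator_of_notMem hbad, add_zero]
        rwa [Set.indicator_of_mem (show y ∈ {y : Fin (n + 1) → ℝ | y 0 < 1 / 8} from hy8)]
      · have := greedyRewardFrom_hardInstance_le hn hδ (y := y) (D := 0) fun t _ _ hpos => by
          obtain ⟨ht1, ht2⟩ := position_lt_one_of_attemptValue_pos hpos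
          refine lt_card_of_notMem_atypicalSeeds hn0 hδ hbad (by simpa using ht1) ?_
          have := Real.exp_le_exp.2 (show 1 / 8 - 1 ≤ y 0 - 1 by linarith)
          rw [Nat.sub_zero, ← ht2]
          exact mul_le_mul_of_nonneg_left (by linarith) hpos.le
        simp only [F, Pi.add_apply, Set.indicator_of_notMem hbad, add_zero]
        rw [Set.indicator_of_notMem (show y ∉ {y : Fin (n + 1) → ℝ | y 0 < 1 / 8} from hy8)]
        simpa using this
  have hi1 : Integrable ({y : Fin (n + 1) → ℝ | y 0 < 1 / 8}.indicator fun _ => k * A)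
      (seedLaw (n + 1)) := (integrable_const _).indicator hm1
  have hi2 : Integrable ((atypicalSeeds n δ).indicator fun _ => 2 * n * A)
      (seedLaw (n + 1)) := (integrable_const _).indicator hm2
  have hF : ∫ y, F y ∂seedLaw (n + 1) = n + k * A * (1 / 8) +
      2 * n * A * (seedLaw (n + 1)).real (atypicalSeeds n δ) := by
    rw [integral_add' ((integrable_const _).add hi1) hi2, integral_add' (integrable_const _) hi1,
      integral_indicator_const _ hm1, integral_indicator_const _ hm2,
      seedLaw_real_lt 0 (by norm_num) (by norm_num)]
    simp only [integral_const, probReal_univ, smul_eq_mul]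
    ring
  unfold perturbedGreedy
  refine (integral_mono_ae ((hardInstance n δ hn hδ).integrable_greedyRewardFrom _ _)
    (((integrable_const _).add hi1).add hi2) hle).trans ?_
  rw [show ∫ y, _ ∂seedLaw (n + 1) = _ from hF]
  gcongr
  exact seedLaw_real_atypicalSeeds_le hn0 hδ

/-! ### The ratio -/

/-- The probability of atypical seeds with `δ = 10⁻⁵`, estimated by `x ^ 2 / 2 ≤ exp x`. -/
lemma mul_exp_neg_le (hn : (10 : ℝ) ^ 26 ≤ n) :
    n * Real.exp (-2 * n * (1 / 10 ^ 5) ^ 2) ≤ 1 / 10 ^ 6 := by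
  have hn0 : (0 : ℝ) < n := lt_of_lt_of_le (by positivity) hn
  have h := Real.quadratic_le_exp_of_nonneg (show 0 ≤ 2 * (n : ℝ) * (1 / 10 ^ 5) ^ 2 by positivity)
  rw [neg_mul, neg_mul, Real.exp_neg, ← div_eq_mul_inv, div_le_iff₀ (Real.exp_pos _)]
  refine le_trans ?_ (mul_le_mul_of_nonneg_left h (by positivity))
  nlinarith

lemma hardInstance_ratio {k : ℕ} (hk : n = 8 * k) (hn : 2 ≤ n) (hn' : (10 : ℝ) ^ 26 ≤ n) :
    0 < (hardInstance n (1 / 10 ^ 5) hn (by norm_num)).offlineOpt ∧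
      (hardInstance n (1 / 10 ^ 5) hn (by norm_num)).perturbedGreedy /
        (hardInstance n (1 / 10 ^ 5) hn (by norm_num)).offlineOpt ≤ 0.624 := by
  have hδ : (0 : ℝ) ≤ 1 / 10 ^ 5 := by norm_num
  have hn0 : (0 : ℝ) < n := lt_of_lt_of_le (by positivity) hn'
  have halg := perturbedGreedy_hardInstance_le hk hn hδ
  have hopt := le_offlineOpt_rareResourceInstance (n := n) (ρ := attemptValue n (1 / 10 ^ 5))
    (ε := 1 / (n : ℝ) ^ 2) (by positivity) attemptValue_nonneg
    (one_div_sq_mul_attemptValue_le_one hn hδ)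
  change _ ≤ (hardInstance n (1 / 10 ^ 5) hn hδ).offlineOpt at hopt
  have hbad := mul_exp_neg_le hn'
  have hninv : 1 / (n : ℝ) ≤ 1 / 10 ^ 26 := one_div_le_one_div_of_le (by positivity) hn'
  have hlower := le_sum_attemptValue (n := n) (δ := 1 / 10 ^ 5) (by omega) hδ
    (by norm_num at hninv ⊢; linarith)
  have hupper : ∑ t ∈ Finset.range n, attemptValue n (1 / 10 ^ 5) t ≤ n * 2 := by
    have := Finset.sum_le_card_nsmul (Finset.range n) (attemptValue n (1 / 10 ^ 5)) 2
      fun t _ => attemptValue_le_two hδ t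
    simpa using this
  have hs0 : 0 ≤ ∑ t ∈ Finset.range n, attemptValue n (1 / 10 ^ 5) t :=
    Finset.sum_nonneg fun t _ => attemptValue_nonneg t
  have hA := attemptValue_le (n := n) hδ 0
  have hA0 := attemptValue_nonneg (n := n) (δ := 1 / 10 ^ 5) 0
  have hV0 := one_sub_exp_pos
  have hV := exp_neg_seven_eighths_bounds.1
  have hα := Real.exp_neg_one_gt_d9
  have hk' : (n : ℝ) = 8 * k := by exact_mod_cast hk
  rw [le_div_iff₀ hV0] at hA
  rw [div_le_iff₀ hV0] at hlower
  set ALG := (hardInstance n (1 / 10 ^ 5) hn (by norm_num)).perturbedGreedy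
  set OPT := (hardInstance n (1 / 10 ^ 5) hn (by norm_num)).offlineOpt
  set s := ∑ t ∈ Finset.range n, attemptValue n (1 / 10 ^ 5) t
  set A := attemptValue n (1 / 10 ^ 5) 0
  set V := 1 - Real.exp (1 / 8 - 1) with hVdef
  set α := Real.exp (-1)
  set b := n * Real.exp (-2 * n * (1 / 10 ^ 5) ^ 2)
  have hsq : 1 / (n : ℝ) ^ 2 * s ^ 2 ≤ 4 := by
    rw [one_div_mul_eq_div, div_le_iff₀ (by positivity)]
    nlinarith
  have hbA : 2 * n * A * b ≤ 2 * n * A * (1 / 10 ^ 6) := by gcongr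
  have hOPT : n + s - 4 ≤ OPT := by linarith
  have hALG : ALG ≤ n * (1 + A * (1 / 64 + 2 / 10 ^ 6)) := by
    have : (k : ℝ) = n / 8 := by linarith
    rw [this] at halg
    linarith
  have hOPT0 : 0 < OPT := by
    have : (10 : ℝ) ≤ n := le_trans (by norm_num) hn'
    linarith
  refine ⟨hOPT0, ?_⟩
  rw [div_le_iff₀ hOPT0]
  refine le_of_mul_le_mul_right ?_ hV0
  have h1 : ALG * V ≤ n * (V + (1 - α) * (1 / 64 + 2 / 10 ^ 6)) := by
    calc ALG * V ≤ n * (1 + A * (1 / 64 + 2 / 10 ^ 6)) * V := by gcongr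
      _ = n * (V + A * V * (1 / 64 + 2 / 10 ^ 6)) := by ring
      _ ≤ _ := by gcongr
  have h2 : n * (V + (α - 2 * (1 / 10 ^ 26 + 1 / 10 ^ 5)) - 4 * V * (1 / 10 ^ 26)) ≤ OPT * V := by
    have hn4 : 4 ≤ n * (4 * (1 / 10 ^ 26) : ℝ) := by linarith
    have h3 : (n : ℝ) * (α - 2 * (1 / 10 ^ 26 + 1 / 10 ^ 5)) ≤
        n * (α - 2 * (1 / n + 1 / 10 ^ 5)) := by gcongr
    have h4 := mul_le_mul_of_nonneg_right hOPT hV0.le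
    have h5 := mul_le_mul_of_nonneg_right hn4 hV0.le
    linarith
  -- The limiting inequality `V + (1 - α) / 64 < 0.624 * (V + α)` has a slack of about `4 / 10 ^ 4`.
  have h3 : V + (1 - α) * (1 / 64 + 2 / 10 ^ 6) ≤
      0.624 * (V + (α - 2 * (1 / 10 ^ 26 + 1 / 10 ^ 5)) - 4 * V * (1 / 10 ^ 26)) := by
    have hV' : V ≤ 0.5832 := by linarith
    norm_num at hα hV' ⊢
    linarith
  have h4 := mul_le_mul_of_nonneg_left h3 hn0.le
  linarith

end StochasticMatching

end

theorem theorem3 :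
    StochasticMatching.perturbedGreedyCompetitiveRatio ≤ 0.624 ∧
      (0.624 : ℝ) < 1 - 1 / Real.exp 1 := by
  constructor
  · have hn : 2 ≤ 8 * 10 ^ 26 := by norm_num
    obtain ⟨h0, h1⟩ := StochasticMatching.hardInstance_ratio (n := 8 * 10 ^ 26) rfl hn
      (by norm_num)
    exact (csInf_le ⟨0, fun _ => StochasticMatching.perturbedGreedyRatios_nonneg⟩
      ⟨_, _, _, h0, rfl⟩).trans h1
  · have := Real.exp_neg_one_lt_d9
    rw [one_div, ← Real.exp_neg]
    norm_num at this ⊢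
    linarith
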